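/- Let $G$ be a finite, simple, connected graph of order $n$ with minimum degree $\delta$. Then $G$ has a spanning tree $T$ such that for every integer $k\ge 1$ $$SW_k(T) \le \frac{k-1}{k+1}\,\frac{3(n+1)}{\delta+1}\binom{n}{k} + \Big(\frac{3\delta}{\delta+1}+2k\Big)\binom{n}{k}.$$ Here, for a connected graph $H$ and a nonempty set $S$ of its vertices, the Steiner distance $d_H(S)$ is the minimum number of edges of a connected subgraph of $H$ whose vertex set contains $S$, and the Steiner $k$-Wiener index is $SW_k(H)=\sum_{S\subseteq V(H),\,|S|=k} d_H(S)$. -/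

import Mathlib

/-- The Steiner distance `d_G(S)` of a set `S` of vertices: the minimum size (number of edges)
of a connected subgraph of `G` whose vertex set contains `S`. (It is meant for nonempty `S` in a
finite connected graph `G`; then `G` itself is such a subgraph.) -/
noncomputable def SimpleGraph.steinerDist {V : Type*} (G : SimpleGraph V) (S : Set V) : ℕ :=
  sInf {m : ℕ | ∃ H : G.Subgraph, H.Connected ∧ S ⊆ H.verts ∧ H.edgeSet.ncard = m}

/-- The Steiner `k`-Wiener index `SW_k(G)`: the sum of the Steiner distances of all
`k`-element sets of vertices. -/
noncomputable def SimpleGraph.steinerWienerIndex {V : Type*} [Fintype V] (G : SimpleGraph V)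
    (k : ℕ) : ℕ :=
  ∑ S ∈ (Finset.univ : Finset V).powersetCard k, G.steinerDist (S : Set V)

/-!
The spanning tree comes from a greedy packing. Pick centres `a 0, a 1, …` with pairwise disjoint
closed neighbourhoods, each at distance three from an earlier centre `a (p i)`, until no further
centre can be added; then every vertex is within distance two of a centre
(`SimpleGraph.Connected.exists_dominating_linkedPacking`). The stars around the centres, the paths
of length three linking `a i` to `a (p i)`, and one edge for each remaining vertex form a spanning
tree `T`. Assign each vertex `v` to a centre `a (π v)` within distance two; with `m = δ + 1`, every
centre receives at least `m` vertices, namely its closed neighbourhood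
(`SimpleGraph.Connected.exists_spanningTree_packing`).

The parent map `p` makes the indices a rooted tree. Let `D i` be the set of vertices assigned to
descendants of `i`. To connect a `k`-set `S` in `T`, use three edges for each `i > 0` for which
`D i` splits `S` (contains some but not all members of `S`), and two edges for each member
of `S` (`SimpleGraph.Connected.steinerDist_le_card_split`). A set of size `d` splits
`f d = C(n, k) - C(d, k) - C(n - d, k)` of the `k`-sets, so it remains to bound `∑ f |D i|`.

The function `f` is symmetric about `n / 2` and increasing up to there, so the sum is controlled by
the numbers `t x` of indices `i` with `x ≤ |D i| ≤ n - x`. Such indices span a tree with at least two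
leaves, whence `m * t x ≤ n - 2 * x + m` (`card_balanced_branches_le`). Among the integers
`0, …, n`, exactly `n - 2 * x + 1` lie in `[x, n - x]`, so `m * ∑ f |D i|` is at most
`∑ j ≤ n, f j + (m - 1) * C(n, k)` (`mul_sum_splitCount_le`), and the hockey-stick identity evaluates
the last sum as `(k - 1) / (k + 1) * (n + 1) * C(n, k)`.
-/

/-! ### Steiner distance -/

namespace SimpleGraph
variable {V : Type*} {G : SimpleGraph V}

theorem Connected.exists_subgraph_ncard_eq_steinerDist (hG : G.Connected) (S : Set V) :
    ∃ H : G.Subgraph, H.Connected ∧ S ⊆ H.verts ∧ H.edgeSet.ncard = G.steinerDist S :=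
  Nat.sInf_mem (s := {m | ∃ H : G.Subgraph, H.Connected ∧ S ⊆ H.verts ∧ H.edgeSet.ncard = m})
    ⟨_, ⊤, by rwa [Subgraph.connected_iff', Subgraph.topIso.connected_iff], by simp, rfl⟩

theorem steinerDist_le {S : Set V} {H : G.Subgraph} (hH : H.Connected) (hS : S ⊆ H.verts) :
    G.steinerDist S ≤ H.edgeSet.ncard :=
  Nat.sInf_le ⟨H, hH, hS, rfl⟩

theorem Connected.steinerDist_mono (hG : G.Connected) {S S' : Set V} (h : S ⊆ S') :
    G.steinerDist S ≤ G.steinerDist S' := by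
  obtain ⟨H, hH, hS, hc⟩ := hG.exists_subgraph_ncard_eq_steinerDist S'
  exact hc ▸ steinerDist_le hH (h.trans hS)

theorem steinerDist_singleton (v : V) : G.steinerDist {v} = 0 := by
  refine Nat.le_zero.1 ((steinerDist_le (H := G.singletonSubgraph v)
    Subgraph.singletonSubgraph_connected (by simp)).trans ?_)
  simp

theorem Connected.steinerDist_insert_le (hG : G.Connected) {S : Set V} {u v : V} (hu : u ∈ S) :
    G.steinerDist (insert v S) ≤ G.steinerDist S + G.dist u v := by
  obtain ⟨H, hH, hS, hc⟩ := hG.exists_subgraph_ncard_eq_steinerDist S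
  obtain ⟨w, hw⟩ := hG.exists_walk_length_eq_dist u v
  have hconn : (H ⊔ w.toSubgraph).Connected :=
    Subgraph.connected_sup hH.preconnected w.toSubgraph_connected.preconnected
      ⟨u, hS hu, w.start_mem_verts_toSubgraph⟩
  refine (steinerDist_le hconn ?_).trans ?_
  · rintro x (rfl | hx)
    · exact Or.inr w.end_mem_verts_toSubgraph
    · exact Or.inl (hS hx)
  · rw [Subgraph.edgeSet_sup, ← hc, ← hw]
    refine (Set.ncard_union_le _ _).trans (Nat.add_le_add_left ?_ _)
    classical
    have : w.toSubgraph.edgeSet = (w.edges.toFinset : Set (Sym2 V)) := by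
      ext e; simp
    rw [this, Set.ncard_coe_finset, ← w.length_edges]
    exact List.toFinset_card_le _

theorem Connected.steinerDist_union_le (hG : G.Connected) {X : Set V} {c : ℕ} (S : Finset V)
    (h : ∀ s ∈ S, ∃ u ∈ X, G.dist u s ≤ c) :
    G.steinerDist (X ∪ S) ≤ G.steinerDist X + c * S.card := by
  classical
  induction S using Finset.induction_on with
  | empty => simp
  | insert s S hs ih =>
    obtain ⟨u, hu, hd⟩ := h s (Finset.mem_insert_self _ _)
    have h1 := ih fun t ht => h t (Finset.mem_insert_of_mem ht)
    have h2 := hG.steinerDist_insert_le (S := X ∪ S) (v := s) (Or.inl hu)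
    rw [Finset.coe_insert, Set.union_insert, Finset.card_insert_of_notMem hs, mul_add_one]
    omega

end SimpleGraph

/-! ### Trees from parent maps, and packings -/

namespace SimpleGraph
variable {V : Type*}

/-- The graph of a parent map `q`: every vertex is joined to its image under `q`. -/
def parentGraph (q : V → V) : SimpleGraph V := fromRel fun u v => q u = v

theorem parentGraph_le {G : SimpleGraph V} {q : V → V} (h : ∀ v, q v ≠ v → G.Adj v (q v)) :
    parentGraph q ≤ G := by
  rintro u v ⟨hne, rfl | rfl⟩
  · exact h u hne.symm
  · exact (h v hne).symm

theorem parentGraph_adj {q : V → V} {v : V} (h : q v ≠ v) : (parentGraph q).Adj v (q v) :=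
  ⟨h.symm, Or.inl rfl⟩

/-- A connected graph of a parent map with a fixed point is a tree: it has at most one edge for
each vertex other than that fixed point. -/
theorem Connected.isTree_parentGraph [Finite V] {q : V → V} (h : (parentGraph q).Connected)
    {r : V} (hr : q r = r) : (parentGraph q).IsTree := by
  refine isTree_iff_connected_and_card.2 ⟨h, le_antisymm ?_ h.card_vert_le_card_edgeSet_add_one⟩
  have hsub : (parentGraph q).edgeSet ⊆ (fun v => s(v, q v)) '' {r}ᶜ := by
    intro e
    induction e with | _ u v
    intro (huv : (parentGraph q).Adj u v)
    obtain ⟨hne, rfl | rfl⟩ := huv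
    · exact ⟨u, fun hu => hne (by rw [Set.mem_singleton_iff.1 hu, hr]), rfl⟩
    · exact ⟨v, fun hv => hne (by rw [Set.mem_singleton_iff.1 hv, hr]), Sym2.eq_swap⟩
  have h1 := (Set.ncard_le_ncard hsub).trans (Set.ncard_image_le (Set.toFinite _))
  have h2 := Set.ncard_add_ncard_compl {r}
  rw [Set.ncard_singleton] at h2
  rw [Nat.card_coe_set_eq]
  omega

/-- A sequence `a 0, …, a (N - 1)` of vertices with pairwise disjoint closed neighbourhoods such
that every `a i` with `i > 0` is joined by a walk of length three, through `u i` and `w i`, to an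
earlier member `a (p i)` of the sequence. -/
structure IsLinkedPacking (G : SimpleGraph V) (N : ℕ) (a u w : ℕ → V) (p : ℕ → ℕ) : Prop where
  parent_le : ∀ i, p i ≤ i
  parent_lt : ∀ i, 0 < i → i < N → p i < i
  adj_left : ∀ i, 0 < i → i < N → G.Adj (a (p i)) (u i)
  adj_mid : ∀ i, 0 < i → i < N → G.Adj (u i) (w i)
  adj_right : ∀ i, 0 < i → i < N → G.Adj (w i) (a i)
  disjoint : ∀ i < N, ∀ j < N, ∀ v, (v = a i ∨ G.Adj v (a i)) → (v = a j ∨ G.Adj v (a j)) → i = j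

namespace IsLinkedPacking
variable {G : SimpleGraph V} {N : ℕ} {a u w : ℕ → V} {p : ℕ → ℕ}

/-- The length is bounded because the members of the sequence are distinct. -/
theorem le_card [Fintype V] (h : G.IsLinkedPacking N a u w p) : N ≤ Fintype.card V := by
  have : Function.Injective fun i : Fin N => a i := fun i j hij =>
    Fin.ext (h.disjoint i i.2 j j.2 (a i) (Or.inl rfl) (Or.inl hij))
  simpa using Fintype.card_le_of_injective _ this

theorem extend (h : G.IsLinkedPacking N a u w p) {i : ℕ} (hi : i < N) {x y z : V}
    (hx : G.Adj (a i) x) (hxy : G.Adj x y) (hyz : G.Adj y z)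
    (hz : ∀ j < N, ∀ v, (v = a j ∨ G.Adj v (a j)) → ¬ (v = z ∨ G.Adj v z)) :
    G.IsLinkedPacking (N + 1) (Function.update a N z) (Function.update u N x)
      (Function.update w N y) (Function.update p N i) := by
  have hlt : ∀ {j}, j < N + 1 → j = N ∨ (j < N ∧ j ≠ N) := by omega
  have hp : ∀ {j}, 0 < j → j < N → p j ≠ N := fun h0 hj =>
    (h.parent_lt _ h0 hj |>.trans hj).ne
  constructor
  · intro j
    rcases eq_or_ne j N with rfl | hj
    · simpa using hi.le
    · simpa [hj] using h.parent_le j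
  · intro j h0 hj
    rcases hlt hj with rfl | ⟨hj, hne⟩
    · simpa using hi
    · simpa [hne] using h.parent_lt j h0 hj
  · intro j h0 hj
    rcases hlt hj with rfl | ⟨hj, hne⟩
    · simpa [hi.ne] using hx
    · simpa [hne, hp h0 hj] using h.adj_left j h0 hj
  · intro j h0 hj
    rcases hlt hj with rfl | ⟨hj, hne⟩
    · simpa using hxy
    · simpa [hne] using h.adj_mid j h0 hj
  · intro j h0 hj
    rcases hlt hj with rfl | ⟨hj, hne⟩
    · simpa using hyz
    · simpa [hne] using h.adj_right j h0 hj
  · intro j hj l hl v hv hv'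
    rcases hlt hj with rfl | ⟨hj, hne⟩ <;> rcases hlt hl with rfl | ⟨hl, hne'⟩
    · rfl
    · simp only [Function.update_self, Function.update_of_ne hne'] at hv hv'
      exact absurd hv (hz l hl v hv')
    · simp only [Function.update_self, Function.update_of_ne hne] at hv hv'
      exact absurd hv' (hz j hj v hv)
    · simp only [Function.update_of_ne hne, Function.update_of_ne hne'] at hv hv'
      exact h.disjoint j hj l hl v hv hv'

end IsLinkedPacking

/-- A linked packing of maximum length dominates the graph up to distance two: a vertex farther
away could be chosen at distance exactly three and appended. -/
theorem Connected.exists_dominating_linkedPacking [Fintype V] {G : SimpleGraph V}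
    (hG : G.Connected) :
    ∃ N a u w p, 0 < N ∧ G.IsLinkedPacking N a u w p ∧
      ∀ v, ∃ x, (v = x ∨ G.Adj v x) ∧ ∃ i < N, x = a i ∨ G.Adj x (a i) := by
  classical
  obtain ⟨v₀⟩ := hG.nonempty
  let P : ℕ → Prop := fun N => ∃ a u w p, G.IsLinkedPacking N a u w p
  have hP1 : P 1 := by
    refine ⟨fun _ => v₀, fun _ => v₀, fun _ => v₀, fun _ => 0, ?_, ?_, ?_, ?_, ?_, ?_⟩ <;>
      intros <;> omega
  have hcard : 1 ≤ Fintype.card V := Fintype.card_pos_iff.2 ⟨v₀⟩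
  set N := Nat.findGreatest P (Fintype.card V)
  have hN1 : 1 ≤ N := Nat.le_findGreatest hcard hP1
  obtain ⟨a, u, w, p, h⟩ : P N := Nat.findGreatest_spec hcard hP1
  refine ⟨N, a, u, w, p, hN1, h, ?_⟩
  by_contra! hv
  obtain ⟨v, hv⟩ := hv
  let D : Set V := {v | ∃ x, (v = x ∨ G.Adj v x) ∧ ∃ i < N, x = a i ∨ G.Adj x (a i)}
  obtain ⟨q⟩ := hG.preconnected (a 0) v
  obtain ⟨⟨⟨y, z⟩, hyz⟩, -, hy, hz⟩ := q.exists_boundary_dart D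
    ⟨a 0, Or.inl rfl, 0, hN1, Or.inl rfl⟩
    (by rintro ⟨x, hx, i, hi, hxi⟩; have := hv x hx i hi; tauto)
  dsimp only at hy hz hyz
  obtain ⟨x, hyx, i, hi, hxi⟩ := hy
  -- `y` is not in a closed neighbourhood of the packing, since `z` is not within distance two.
  have hy1 : ∀ j < N, ¬ (y = a j ∨ G.Adj y (a j)) := fun j hj hyj =>
    hz ⟨y, Or.inr hyz.symm, j, hj, hyj⟩
  have hyx' : G.Adj y x := hyx.resolve_left <| by
    rintro rfl
    exact hy1 i hi hxi
  have hxi' : G.Adj x (a i) := hxi.resolve_left <| by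
    rintro rfl
    exact hy1 i hi (Or.inr hyx')
  have hnew := h.extend hi hxi'.symm hyx'.symm hyz fun j hj v hvj hvz =>
    hz ⟨v, hvz.imp Eq.symm Adj.symm, j, hj, hvj⟩
  have := Nat.le_findGreatest hnew.le_card (show P (N + 1) from ⟨_, _, _, _, hnew⟩)
  omega

end SimpleGraph

/-! ### Branches of a rooted tree -/

/-- `IsAncestor p i j`: the vertex `i` lies on the path from `j` towards the root, in the rooted tree
on `ℕ` in which `p` sends each vertex to its parent. Every vertex is an ancestor of itself. -/
def IsAncestor (p : ℕ → ℕ) (i j : ℕ) : Prop := ∃ t, p^[t] j = i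

namespace IsAncestor
variable {p : ℕ → ℕ} {i j l : ℕ}

theorem refl (p : ℕ → ℕ) (i : ℕ) : IsAncestor p i i := ⟨0, rfl⟩

theorem trans (h : IsAncestor p i j) (h' : IsAncestor p j l) : IsAncestor p i l := by
  obtain ⟨s, rfl⟩ := h
  obtain ⟨t, rfl⟩ := h'
  exact ⟨s + t, Function.iterate_add_apply ..⟩

theorem iff_eq_or_parent : IsAncestor p i j ↔ i = j ∨ IsAncestor p i (p j) := by
  constructor
  · rintro ⟨_ | t, rfl⟩
    · exact Or.inl rfl
    · exact Or.inr ⟨t, rfl⟩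
  · rintro (rfl | ⟨t, rfl⟩)
    · exact refl p i
    · exact ⟨t + 1, rfl⟩

theorem total (h : IsAncestor p i l) (h' : IsAncestor p j l) :
    IsAncestor p i j ∨ IsAncestor p j i := by
  obtain ⟨s, rfl⟩ := h
  obtain ⟨t, rfl⟩ := h'
  rcases le_total s t with hst | hst
  · exact Or.inr ⟨t - s, by rw [← Function.iterate_add_apply, Nat.sub_add_cancel hst]⟩
  · exact Or.inl ⟨s - t, by rw [← Function.iterate_add_apply, Nat.sub_add_cancel hst]⟩

theorem le (hp : ∀ i, p i ≤ i) (h : IsAncestor p i j) : i ≤ j := by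
  obtain ⟨t, rfl⟩ := h
  induction t with
  | zero => rfl
  | succ t ih => rw [Function.iterate_succ_apply']; exact (hp _).trans ih

end IsAncestor

section Branches
variable {V : Type*} [Fintype V]

open Classical in
/-- The branch at `i`: the elements whose image under `π` is a descendant of `i`. -/
noncomputable def branch (p : ℕ → ℕ) (π : V → ℕ) (i : ℕ) : Finset V :=
  Finset.univ.filter fun v => IsAncestor p i (π v)

theorem mem_branch {p : ℕ → ℕ} {π : V → ℕ} {i : ℕ} {v : V} :
    v ∈ branch p π i ↔ IsAncestor p i (π v) := by
  simp [branch]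

/-- If all fibres of `π` have at least `m` elements, then few branches have size in
`[x, |V| - x]`. Contracting all edges of the tree on the indices except those above the members of
a nonempty `I` leaves a tree with `I.card + 1` vertices, each carrying at least `m` elements of `V`; its leaves,
of which there are at least two, carry at least `x` elements each. -/
theorem card_balanced_branches_le {p : ℕ → ℕ} {π : V → ℕ} {N m x : ℕ} (hp : ∀ i, p i ≤ i)
    (hm : ∀ i < N, m ≤ (Finset.univ.filter fun v => π v = i).card)
    (hx : 2 * x ≤ Fintype.card V) (I : Finset ℕ) (hI : ∀ i ∈ I, 0 < i ∧ i < N ∧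
      x ≤ (branch p π i).card ∧ (branch p π i).card + x ≤ Fintype.card V) :
    m * I.card + 2 * x ≤ Fintype.card V + m := by
  classical
  rcases I.eq_empty_or_nonempty with rfl | hne
  · simp; omega
  set F : ℕ → Finset V := fun i => Finset.univ.filter fun v => π v = i with hF
  -- Two disjoint sets of size at least `x`, together with disjoint fibres, fit into `V`.
  have key : ∀ (X Y : Finset V) (J : Finset ℕ), Disjoint X Y → x ≤ X.card → x ≤ Y.card →
      (∀ j ∈ J, j < N) → (∀ j ∈ J, ∀ v, π v = j → v ∉ X ∧ v ∉ Y) →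
      2 * x + m * J.card ≤ Fintype.card V := by
    intro X Y J hXY hX hY hJ hd
    have h1 : Disjoint (X ∪ Y) (J.biUnion F) := by
      rw [Finset.disjoint_left]
      intro v hv hv'
      simp only [hF, Finset.mem_biUnion, Finset.mem_filter, Finset.mem_univ, true_and] at hv'
      obtain ⟨j, hj, hvj⟩ := hv'
      have := hd j hj v hvj
      simp_all
    have h2 : m * J.card ≤ (J.biUnion F).card := by
      rw [Finset.card_biUnion, mul_comm, ← smul_eq_mul]
      · exact Finset.card_nsmul_le_sum _ _ _ fun j hj => hm j (hJ j hj)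
      · intro i _ j _ hij
        rw [Function.onFun, Finset.disjoint_left]
        intro v hv hv'
        simp only [hF, Finset.mem_filter, Finset.mem_univ, true_and] at hv hv'
        exact hij (hv.symm.trans hv')
    have h3 := Finset.card_le_univ ((X ∪ Y) ∪ J.biUnion F)
    rw [Finset.card_union_of_disjoint h1, Finset.card_union_of_disjoint hXY] at h3
    omega
  -- The largest index of `I` has no proper descendant in `I`.
  obtain ⟨i₀, hi₀, hmax⟩ := I.exists_max_image id hne
  simp only [id] at hmax
  have hleaf₀ : ∀ j ∈ I, j ≠ i₀ → ¬ IsAncestor p i₀ j := fun j hj hne h =>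
    hne (le_antisymm (hmax j hj) (h.le hp))
  by_cases hchain : ∀ j ∈ I, IsAncestor p j i₀
  · -- `I` is a chain: use the branch at its bottom and the complement of the branch at its top.
    obtain ⟨i₁, hi₁, hmin⟩ := I.exists_min_image id hne
    simp only [id] at hmin
    have htop : ∀ j ∈ I, IsAncestor p i₁ j := by
      intro j hj
      rcases (hchain i₁ hi₁).total (hchain j hj) with h | h
      · exact h
      · rw [le_antisymm (hmin j hj) (h.le hp)]; exact IsAncestor.refl p j
    have := key (branch p π i₀) (branch p π i₁)ᶜ (I.erase i₀) ?_ (hI i₀ hi₀).2.2.1 ?_ ?_ ?_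
    · rw [Finset.card_erase_of_mem hi₀] at this
      obtain ⟨c, hc⟩ : ∃ c, I.card = c + 1 := ⟨I.card - 1, by have := hne.card_pos; omega⟩
      rw [hc, Nat.add_sub_cancel] at this
      rw [hc, mul_add_one]
      omega
    · rw [Finset.disjoint_left]
      intro v hv
      simpa [mem_branch] using (htop i₀ hi₀).trans (mem_branch.1 hv)
    · have := (hI i₁ hi₁).2.2.2
      rw [Finset.card_compl]; omega
    · exact fun j hj => (hI j (Finset.mem_of_mem_erase hj)).2.1
    · rintro j hj v rfl
      rw [Finset.mem_erase] at hj
      simpa [mem_branch] using ⟨hleaf₀ _ hj.2 hj.1, htop _ hj.2⟩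
  · -- Otherwise a second member of `I` has no proper descendant in `I`, and the root adds a fibre.
    push Not at hchain
    obtain ⟨j₀, hj₀, hj₀'⟩ := hchain
    obtain ⟨i₁, hi₁, hmax₁⟩ := (I.filter fun j => ¬ IsAncestor p j i₀).exists_max_image id
      ⟨j₀, by simp [hj₀, hj₀']⟩
    simp only [id, Finset.mem_filter] at hmax₁ hi₁
    have hleaf₁ : ∀ j ∈ I, j ≠ i₁ → ¬ IsAncestor p i₁ j := by
      intro j hj hne h
      refine hne (le_antisymm (hmax₁ j ⟨hj, fun h' => hi₁.2 (h.trans h')⟩) (h.le hp))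
    have hne₁ : i₁ ≠ i₀ := by
      rintro rfl
      exact hi₁.2 (IsAncestor.refl p _)
    have h0 : 0 ∉ I := fun h => (hI 0 h).1.false
    have := key (branch p π i₀) (branch p π i₁) (insert 0 ((I.erase i₀).erase i₁)) ?_
      (hI i₀ hi₀).2.2.1 (hI i₁ hi₁.1).2.2.1 ?_ ?_
    · have hmem : i₁ ∈ I.erase i₀ := Finset.mem_erase.2 ⟨hne₁, hi₁.1⟩
      have hpos := Finset.card_pos.2 ⟨i₁, hmem⟩
      rw [Finset.card_insert_of_notMem (by simp [h0]), Finset.card_erase_of_mem hmem] at this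
      rw [Finset.card_erase_of_mem hi₀] at this hpos
      obtain ⟨c, hc⟩ : ∃ c, I.card = c + 2 := ⟨I.card - 2, by omega⟩
      rw [hc, show c + 2 - 1 - 1 + 1 = c + 1 by omega] at this
      rw [hc, show c + 2 = c + 1 + 1 by rfl, mul_add_one]
      omega
    · rw [Finset.disjoint_left]
      intro v hv hv'
      rcases (mem_branch.1 hv).total (mem_branch.1 hv') with h | h
      · exact hleaf₀ i₁ hi₁.1 hne₁ h
      · exact hi₁.2 h
    · simp only [Finset.mem_insert, Finset.mem_erase]
      rintro j (rfl | hj)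
      · exact (hI i₀ hi₀).1.trans (hI i₀ hi₀).2.1
      · exact (hI j hj.2.2).2.1
    · simp only [Finset.mem_insert, Finset.mem_erase, mem_branch]
      rintro j (rfl | hj) v hv
      · rw [hv]
        exact ⟨fun h => absurd (h.le hp) (hI i₀ hi₀).1.not_ge,
          fun h => absurd (h.le hp) (hI i₁ hi₁.1).1.not_ge⟩
      · rw [hv]
        exact ⟨hleaf₀ j hj.2.2 hj.2.1, hleaf₁ j hj.2.2 hj.1⟩

end Branches

/-! ### Counting split subsets -/

/-- The number of `k`-subsets of an `n`-set that meet both a given `x`-subset and its complement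
(for `k ≥ 1` and `x ≤ n`). -/
def splitCount (n k x : ℕ) : ℝ := n.choose k - x.choose k - (n - x).choose k

theorem splitCount_symm {n x : ℕ} (k : ℕ) (hx : x ≤ n) :
    splitCount n k (n - x) = splitCount n k x := by
  rw [splitCount, splitCount, Nat.sub_sub_self hx]; ring

theorem splitCount_le (n k x : ℕ) : splitCount n k x ≤ n.choose k := by
  unfold splitCount
  have h1 : (0 : ℝ) ≤ x.choose k := by positivity
  have h2 : (0 : ℝ) ≤ (n - x).choose k := by positivity
  linarith

theorem splitCount_mono {n k x : ℕ} (hk : 1 ≤ k) (hx : 2 * (x + 1) ≤ n) :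
    splitCount n k x ≤ splitCount n k (x + 1) := by
  obtain ⟨k, rfl⟩ := Nat.exists_eq_add_of_le' hk
  obtain ⟨y, rfl⟩ : ∃ y, n = x + 1 + y := ⟨n - (x + 1), by omega⟩
  have h : (x.choose k : ℝ) ≤ y.choose k := by
    exact_mod_cast Nat.choose_le_choose k (by omega)
  rw [splitCount, splitCount, show x + 1 + y - x = y + 1 by omega,
    show x + 1 + y - (x + 1) = y by omega, Nat.choose_succ_succ x, Nat.choose_succ_succ y]
  push_cast
  linarith

/-- Layer-cake formula: up to the symmetry `j ↦ n - j`, the value at `j` is the sum of the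
(nonnegative) increments of `splitCount n k` over the levels `x + 1 ≤ min j (n - j)`. -/
theorem splitCount_eq_sum {n k j : ℕ} (hk : 1 ≤ k) (hj : j ≤ n) :
    splitCount n k j = ∑ x ∈ Finset.range (n / 2),
      if x + 1 ≤ j ∧ j + (x + 1) ≤ n then splitCount n k (x + 1) - splitCount n k x else 0 := by
  rw [← Finset.sum_filter]
  have h0 : splitCount n k 0 = 0 := by
    simp [splitCount, Nat.choose_eq_zero_of_lt hk]
  have : (Finset.range (n / 2)).filter (fun x => x + 1 ≤ j ∧ j + (x + 1) ≤ n) =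
      Finset.range (min j (n - j)) := by
    ext x; simp; omega
  rw [this, Finset.sum_range_sub, h0, sub_zero]
  rcases le_total j (n - j) with h | h
  · rw [min_eq_left h]
  · rw [min_eq_right h, splitCount_symm k hj]

/-- The hockey-stick identity, applied to each of the two subtracted terms. -/
theorem sum_splitCount (n k : ℕ) :
    ∑ j ∈ Finset.range (n + 1), splitCount n k j =
      ((k : ℝ) - 1) / (k + 1) * (n + 1) * n.choose k := by
  have h1 : ∑ j ∈ Finset.range (n + 1), (j.choose k : ℝ) = (n + 1).choose (k + 1) := by
    norm_cast
    induction n with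
    | zero => rcases k with _ | k <;> simp [Nat.choose_eq_zero_of_lt]
    | succ n ih => rw [Finset.sum_range_succ, ih, Nat.choose_succ_succ (n + 1), add_comm]
  have h2 : ∑ j ∈ Finset.range (n + 1), ((n - j).choose k : ℝ) = (n + 1).choose (k + 1) := by
    rw [← h1, ← Finset.sum_range_reflect]
    refine Finset.sum_congr rfl fun j hj => ?_
    rw [Finset.mem_range] at hj
    rw [show n - (n + 1 - 1 - j) = j by omega]
  have h3 : ((n : ℝ) + 1) * n.choose k = (n + 1).choose (k + 1) * (k + 1) := by
    exact_mod_cast Nat.add_one_mul_choose_eq n k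
  simp only [splitCount, Finset.sum_sub_distrib, h1, h2]
  rw [Finset.sum_const, Finset.card_range, nsmul_eq_mul]
  push_cast
  have hk : (k : ℝ) + 1 ≠ 0 := by positivity
  field_simp
  linear_combination (2 : ℝ) * h3

/-- If for every level `x` only about `(n - 2 * x) / m + 1` of the sizes `d i` lie in `[x, n - x]`,
then `∑ splitCount n k (d i)` is at most what sizes spread over `[0, n]` with gaps `m` give. The
proof compares the two sums level by level: exactly `n + 1 - 2 * x` of the integers `0, …, n` lie in
`[x, n - x]`, and the excess `m - 1` is paid for by the maximum of `splitCount n k`. -/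
theorem mul_sum_splitCount_le {n k m : ℕ} (hk : 1 ≤ k) (hm : 1 ≤ m) (I : Finset ℕ) (d : ℕ → ℕ)
    (hd : ∀ i ∈ I, d i ≤ n)
    (h : ∀ x, 2 * x ≤ n → m * (I.filter fun i => x ≤ d i ∧ d i + x ≤ n).card + 2 * x ≤ n + m) :
    m * ∑ i ∈ I, splitCount n k (d i) ≤
      ((k : ℝ) - 1) / (k + 1) * (n + 1) * n.choose k + (m - 1) * n.choose k := by
  set Δ : ℕ → ℝ := fun x => splitCount n k (x + 1) - splitCount n k x
  have hΔ0 : ∀ x ∈ Finset.range (n / 2), 0 ≤ Δ x := fun x hx => by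
    rw [Finset.mem_range] at hx
    exact sub_nonneg.2 (splitCount_mono hk (by omega))
  have h1 : ∑ i ∈ I, splitCount n k (d i) = ∑ x ∈ Finset.range (n / 2),
      (I.filter fun i => x + 1 ≤ d i ∧ d i + (x + 1) ≤ n).card * Δ x := by
    rw [Finset.sum_congr rfl fun i hi => splitCount_eq_sum hk (hd i hi), Finset.sum_comm]
    refine Finset.sum_congr rfl fun x _ => ?_
    rw [← Finset.sum_filter, Finset.sum_const, nsmul_eq_mul]
  have h2 : ∑ j ∈ Finset.range (n + 1), splitCount n k j = ∑ x ∈ Finset.range (n / 2),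
      ((n : ℝ) + 1 - 2 * (x + 1)) * Δ x := by
    rw [Finset.sum_congr rfl fun j hj =>
      splitCount_eq_sum hk (Nat.lt_succ_iff.1 (Finset.mem_range.1 hj)), Finset.sum_comm]
    refine Finset.sum_congr rfl fun x hx => ?_
    rw [Finset.mem_range] at hx
    rw [← Finset.sum_filter, Finset.sum_const, nsmul_eq_mul]
    have : (Finset.range (n + 1)).filter (fun j => x + 1 ≤ j ∧ j + (x + 1) ≤ n) =
        Finset.Icc (x + 1) (n - (x + 1)) := by
      ext j; simp; omega
    rw [this, Nat.card_Icc]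
    have : ((n - (x + 1) + 1 - (x + 1) : ℕ) : ℝ) = (n : ℝ) + 1 - 2 * (x + 1) := by
      rw [eq_sub_iff_add_eq]
      exact_mod_cast (by omega : n - (x + 1) + 1 - (x + 1) + 2 * (x + 1) = n + 1)
    rw [this]
  have h3 : ∑ x ∈ Finset.range (n / 2), Δ x ≤ n.choose k := by
    rw [Finset.sum_range_sub]
    have : splitCount n k 0 = 0 := by simp [splitCount, Nat.choose_eq_zero_of_lt hk]
    rw [this, sub_zero]
    exact splitCount_le _ _ _
  have hm' : (0 : ℝ) ≤ m - 1 := sub_nonneg.2 (by exact_mod_cast hm)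
  calc m * ∑ i ∈ I, splitCount n k (d i)
      ≤ ∑ x ∈ Finset.range (n / 2), (((n : ℝ) + 1 - 2 * (x + 1)) * Δ x + (m - 1) * Δ x) := by
        rw [h1, Finset.mul_sum]
        refine Finset.sum_le_sum fun x hx => ?_
        rw [← mul_assoc, ← add_mul]
        refine mul_le_mul_of_nonneg_right ?_ (hΔ0 x hx)
        rw [Finset.mem_range] at hx
        have h5 := h (x + 1) (by omega)
        have h6 : (m : ℝ) * (I.filter fun i => x + 1 ≤ d i ∧ d i + (x + 1) ≤ n).card
            + 2 * (x + 1) ≤ n + m := by exact_mod_cast h5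
        linarith
    _ = ∑ j ∈ Finset.range (n + 1), splitCount n k j
          + (m - 1) * ∑ x ∈ Finset.range (n / 2), Δ x := by
        rw [Finset.sum_add_distrib, h2, Finset.mul_sum]
    _ ≤ _ := by
        rw [sum_splitCount]
        gcongr

theorem card_powersetCard_split {V : Type*} [Fintype V] [DecidableEq V] {k : ℕ} (hk : 1 ≤ k)
    (D : Finset V) :
    ((((Finset.univ : Finset V).powersetCard k).filter
      fun S => (∃ v ∈ S, v ∈ D) ∧ ∃ v ∈ S, v ∉ D).card : ℝ) =
      splitCount (Fintype.card V) k D.card := by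
  set U := (Finset.univ : Finset V).powersetCard k
  have hU : U.card = (Fintype.card V).choose k := by simp [U]
  have h1 : U.filter (fun S => ¬ ((∃ v ∈ S, v ∈ D) ∧ ∃ v ∈ S, v ∉ D)) =
      D.powersetCard k ∪ Dᶜ.powersetCard k := by
    ext S
    simp only [U, Finset.mem_filter, Finset.mem_powersetCard, Finset.mem_union,
      Finset.subset_iff, Finset.mem_compl, Finset.mem_univ]
    grind
  have h2 : Disjoint (D.powersetCard k) (Dᶜ.powersetCard k) := by
    rw [Finset.disjoint_left]
    intro S hS hS'
    rw [Finset.mem_powersetCard] at hS hS'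
    obtain ⟨v, hv⟩ : S.Nonempty := Finset.card_pos.1 (by omega)
    exact Finset.mem_compl.1 (hS'.1 hv) (hS.1 hv)
  have h3 := Finset.card_filter_add_card_filter_not (s := U)
    (fun S => (∃ v ∈ S, v ∈ D) ∧ ∃ v ∈ S, v ∉ D)
  rw [h1, Finset.card_union_of_disjoint h2, Finset.card_powersetCard, Finset.card_powersetCard,
    hU, Finset.card_compl] at h3
  rw [splitCount, ← h3]
  push_cast
  ring

/-! ### The spanning tree and its Steiner distances -/

namespace SimpleGraph
variable {V : Type*}

/-- A spanning tree in which every vertex `v` is within distance two of its centre `a (π v)`, each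
centre other than `a 0` is within distance three of an earlier one, and every centre is assigned at
least `G.minDegree + 1` vertices. -/
theorem Connected.exists_spanningTree_packing [Fintype V] {G : SimpleGraph V}
    [DecidableRel G.Adj] (hG : G.Connected) :
    ∃ T ≤ G, T.IsTree ∧ ∃ (N : ℕ) (a : ℕ → V) (p : ℕ → ℕ) (π : V → ℕ), (∀ i, p i ≤ i) ∧
      (∀ i, 0 < i → i < N → p i < i ∧ T.dist (a (p i)) (a i) ≤ 3) ∧
      (∀ v, π v < N ∧ T.dist (a (π v)) v ≤ 2) ∧
      ∀ i < N, G.minDegree + 1 ≤ (Finset.univ.filter fun v => π v = i).card := by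
  classical
  obtain ⟨N, a, u, w, p, hN, h, hdom⟩ := hG.exists_dominating_linkedPacking
  have hπ : ∀ v, ∃ i x, i < N ∧ (v = x ∨ G.Adj v x) ∧ (x = a i ∨ G.Adj x (a i)) ∧
      ∀ j < N, v = a j ∨ G.Adj v (a j) → i = j := by
    intro v
    by_cases hv : ∃ i < N, v = a i ∨ G.Adj v (a i)
    · obtain ⟨i, hi, hvi⟩ := hv
      exact ⟨i, v, hi, Or.inl rfl, hvi, fun j hj hvj => h.disjoint i hi j hj v hvi hvj⟩
    · push Not at hv
      obtain ⟨x, hvx, i, hi, hxi⟩ := hdom v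
      exact ⟨i, x, hi, hvx, hxi, fun j hj hvj =>
        (hvj.elim (hv j hj).1 (hv j hj).2).elim⟩
  choose π x hπN hvx hxπ hπ using hπ
  have haa : ∀ i < N, ∀ j < N, a i = a j → i = j := fun i hi j hj e =>
    h.disjoint i hi j hj (a i) (Or.inl rfl) (Or.inl e)
  have hadj : ∀ i < N, ∀ j < N, ¬ G.Adj (a i) (a j) := fun i hi j hj e => by
    obtain rfl := h.disjoint i hi j hj (a i) (Or.inl rfl) (Or.inr e)
    exact e.ne rfl
  have hnn : ∀ i < N, ∀ j < N, ∀ v, G.Adj v (a i) → G.Adj v (a j) → i = j :=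
    fun i hi j hj v hvi hvj => h.disjoint i hi j hj v (Or.inr hvi) (Or.inr hvj)
  -- The parent map: stars around the `a i`, linked through `u i` and `w i`, and all other
  -- vertices attached as leaves to these stars.
  have hq : ∀ v, ∃ y, (v = a 0 → y = v) ∧ (v ≠ a 0 → G.Adj v y) ∧
      (∀ i, 0 < i → i < N → v = a i → y = w i) ∧ (∀ i, 0 < i → i < N → v = w i → y = u i) ∧
      (∀ i < N, G.Adj v (a i) → (0 < i → v ≠ w i) → y = a i) ∧
      ((∀ i < N, ¬ (v = a i ∨ G.Adj v (a i))) → y = a (π v) ∨ G.Adj y (a (π v))) := by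
    intro v
    by_cases hv : ∃ i < N, v = a i
    · obtain ⟨i, hi, rfl⟩ := hv
      have hw : ∀ j, 0 < j → j < N → a i ≠ w j := fun j h0 hj e =>
        hadj i hi j hj (e ▸ h.adj_right j h0 hj)
      rcases Nat.eq_zero_or_pos i with rfl | h0
      · refine ⟨a 0, fun _ => rfl, fun h => (h rfl).elim, fun j hj0 hj e => ?_,
          fun j hj0 hj e => (hw j hj0 hj e).elim, fun j hj e => (hadj _ hi j hj e).elim,
          fun h => (h _ hi (Or.inl rfl)).elim⟩
        exact absurd (haa 0 hi j hj e) hj0.ne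
      · refine ⟨w i, fun e => absurd (haa i hi 0 hN e) h0.ne', fun _ => (h.adj_right i h0 hi).symm,
          fun j hj0 hj e => ?_, fun j hj0 hj e => (hw j hj0 hj e).elim,
          fun j hj e => (hadj _ hi j hj e).elim, fun h => (h _ hi (Or.inl rfl)).elim⟩
        rw [haa i hi j hj e]
    push Not at hv
    by_cases hv' : ∃ i < N, G.Adj v (a i)
    · obtain ⟨i, hi, hvi⟩ := hv'
      by_cases hvw : 0 < i ∧ v = w i
      · refine ⟨u i, fun e => (hv 0 hN e).elim, fun _ => ?_, fun j _ hj e => (hv j hj e).elim,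
          fun j hj0 hj e => ?_, fun j hj e hne => ?_, fun h => (h _ hi (Or.inr hvi)).elim⟩
        · rw [hvw.2]
          exact (h.adj_mid i hvw.1 hi).symm
        · rw [hnn i hi j hj v hvi (e ▸ h.adj_right j hj0 hj)]
        · obtain rfl := hnn i hi j hj v hvi e
          exact (hne hvw.1 hvw.2).elim
      · refine ⟨a i, fun e => (hv 0 hN e).elim, fun _ => hvi, fun j _ hj e => (hv j hj e).elim,
          fun j hj0 hj e => ?_, fun j hj e hne => ?_, fun _ => Or.inl ?_⟩
        · obtain rfl := hnn i hi j hj v hvi (e ▸ h.adj_right j hj0 hj)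
          exact (hvw ⟨hj0, e⟩).elim
        · rw [hnn i hi j hj v hvi e]
        · rw [hπ v i hi (Or.inr hvi)]
    · push Not at hv'
      have hne : v ≠ x v := by
        intro e
        have := hxπ v
        rw [← e] at this
        exact this.elim (hv _ (hπN v)) (hv' _ (hπN v))
      exact ⟨x v, fun e => (hv 0 hN e).elim, fun _ => (hvx v).resolve_left hne,
        fun j _ hj e => (hv j hj e).elim,
        fun j hj0 hj e => (hv' j hj (e ▸ h.adj_right j hj0 hj)).elim,
        fun j hj e => (hv' j hj e).elim, fun _ => hxπ v⟩
  choose q hq0 hqG hqa hqw hqn hqx using hq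
  have hq_eq : ∀ v, q v ≠ v ↔ v ≠ a 0 := fun v =>
    ⟨fun hne e => hne (hq0 v e), fun hne => (hqG v hne).ne'⟩
  set T := parentGraph q
  have hTadj : ∀ v, v ≠ a 0 → T.Adj v (q v) := fun v hv => parentGraph_adj ((hq_eq v).2 hv)
  have hstar : ∀ i < N, ∀ v, G.Adj v (a i) → T.Adj v (a i) := by
    intro i hi v hv
    by_cases hvw : 0 < i ∧ v = w i
    · have := hTadj (a i) fun e => hvw.1.ne' (haa i hi 0 hN e)
      rw [hqa _ i hvw.1 hi rfl, ← hvw.2] at this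
      exact this.symm
    · have := hTadj v fun e => hadj 0 hN i hi (e ▸ hv)
      rwa [hqn v i hi hv fun h0 e => hvw ⟨h0, e⟩] at this
  have hlink : ∀ i, 0 < i → i < N → ∃ W : T.Walk (a (p i)) (a i), W.length = 3 := by
    intro i h0 hi
    have h1 := hstar (p i) ((h.parent_lt i h0 hi).trans hi) _ (h.adj_left i h0 hi).symm
    have h2 := hTadj (w i) fun e => hadj 0 hN i hi (e ▸ h.adj_right i h0 hi)
    rw [hqw _ i h0 hi rfl] at h2
    have h3 := hstar i hi _ (h.adj_right i h0 hi)
    exact ⟨.cons h1.symm (.cons h2.symm (.cons h3 .nil)), rfl⟩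
  have hnear : ∀ v, ∃ W : T.Walk (a (π v)) v, W.length ≤ 2 := by
    intro v
    by_cases hv : ∃ i < N, v = a i ∨ G.Adj v (a i)
    · obtain ⟨i, hi, hvi⟩ := hv
      rw [hπ v i hi hvi]
      rcases hvi with rfl | hvi
      · exact ⟨.nil, by simp⟩
      · exact ⟨.cons (hstar i hi v hvi).symm .nil, by simp⟩
    · push Not at hv
      have h1 := hTadj v (hv 0 hN).1
      rcases hqx v fun i hi => not_or.2 (hv i hi) with e | e
      · rw [← e]
        exact ⟨.cons h1.symm .nil, by simp⟩
      · exact ⟨.cons (hstar _ (hπN v) _ e).symm (.cons h1.symm .nil), by simp⟩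
  have hroot : ∀ i < N, T.Reachable (a 0) (a i) := by
    intro i
    induction i using Nat.strong_induction_on with | _ i ih
    intro hi
    rcases Nat.eq_zero_or_pos i with rfl | h0
    · exact Reachable.refl _
    · have hlt := h.parent_lt i h0 hi
      obtain ⟨W, -⟩ := hlink i h0 hi
      exact (ih _ hlt (hlt.trans hi)).trans W.reachable
  have hconn : T.Connected := by
    refine connected_iff_exists_forall_reachable _ |>.2 ⟨a 0, fun v => ?_⟩
    obtain ⟨W, -⟩ := hnear v
    exact (hroot _ (hπN v)).trans W.reachable
  refine ⟨T, parentGraph_le fun v hv => hqG v ((hq_eq v).1 hv),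
    hconn.isTree_parentGraph (hq0 (a 0) rfl), N, a, p, π, h.parent_le, fun i h0 hi => ?_,
    fun v => ?_, fun i hi => ?_⟩
  · obtain ⟨W, hW⟩ := hlink i h0 hi
    exact ⟨h.parent_lt i h0 hi, hW ▸ dist_le W⟩
  · obtain ⟨W, hW⟩ := hnear v
    exact ⟨hπN v, (dist_le W).trans hW⟩
  · -- The fibre over `i` contains the closed neighbourhood of `a i`.
    calc G.minDegree + 1 ≤ G.degree (a i) + 1 := Nat.succ_le_succ (G.minDegree_le_degree _)
      _ = (insert (a i) (G.neighborFinset (a i))).card := by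
        rw [Finset.card_insert_of_notMem (by simp), card_neighborFinset_eq_degree]
      _ ≤ _ := by
        refine Finset.card_le_card fun v hv => ?_
        rw [Finset.mem_insert, mem_neighborFinset] at hv
        rw [Finset.mem_filter]
        exact ⟨Finset.mem_univ _, hπ v i hi (hv.imp_right Adj.symm)⟩

open Classical in
/-- A set of centres is connected by those links `(i, p i)` that separate it in the tree on the
indices, at a cost of `c` edges per link. -/
theorem Connected.steinerDist_image_le {T : SimpleGraph V} (hT : T.Connected) {a : ℕ → V}
    {p : ℕ → ℕ} (hp : ∀ i, p i ≤ i) {c N : ℕ}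
    (h : ∀ i, 0 < i → i < N → p i < i ∧ T.dist (a (p i)) (a i) ≤ c) (J : Finset ℕ)
    (hJ : J.Nonempty) (hJN : ∀ j ∈ J, j < N) :
    T.steinerDist (a '' J) ≤ c * ((Finset.Ico 1 N).filter fun i =>
      (∃ j ∈ J, IsAncestor p i j) ∧ ∃ j ∈ J, ¬ IsAncestor p i j).card := by
  induction N generalizing J with
  | zero => obtain ⟨j, hj⟩ := hJ; exact absurd (hJN j hj) (Nat.not_lt_zero _)
  | succ N ih =>
    have ih := ih fun i h0 hi => h i h0 (hi.trans N.lt_succ_self)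
    have hle : ∀ j ∈ J, j ≠ N → j < N := fun j hj hne =>
      lt_of_le_of_ne (Nat.lt_succ_iff.1 (hJN j hj)) hne
    by_cases hN : N ∈ J
    swap
    · refine (ih J hJ fun j hj => hle j hj (by rintro rfl; exact hN hj)).trans ?_
      gcongr
      exact N.le_succ
    by_cases hJ1 : J = {N}
    · simp [hJ1, steinerDist_singleton]
    obtain ⟨l, hl, hlN⟩ : ∃ l ∈ J, l ≠ N := by
      by_contra! hc
      exact hJ1 (Finset.eq_singleton_iff_unique_mem.2 ⟨hN, hc⟩)
    have hlN' := hle l hl hlN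
    have hN0 : 0 < N := by omega
    obtain ⟨hpN, hd⟩ := h N hN0 N.lt_succ_self
    -- Replace the leaf `N` by its parent; this removes exactly the split at `N`.
    have h1 := ih (insert (p N) (J.erase N)) (Finset.insert_nonempty _ _) (by
      simp only [Finset.mem_insert, Finset.mem_erase]
      rintro j (rfl | ⟨hne, hj⟩)
      · exact hpN
      · exact hle j hj hne)
    have h2 : T.steinerDist (a '' J) ≤
        T.steinerDist (a '' (insert (p N) (J.erase N) : Finset ℕ)) + c := by
      refine (hT.steinerDist_mono ?_).trans ((hT.steinerDist_insert_le (v := a N)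
        (Set.mem_image_of_mem a (Finset.mem_insert_self (p N) (J.erase N)))).trans
          (Nat.add_le_add_left hd _))
      rintro _ ⟨j, hj, rfl⟩
      by_cases hjN : j = N
      · exact Or.inl (by rw [hjN])
      · exact Or.inr ⟨j, Finset.mem_insert_of_mem (Finset.mem_erase.2 ⟨hjN, hj⟩), rfl⟩
    refine h2.trans ((Nat.add_le_add_right h1 c).trans ?_)
    rw [← mul_add_one]
    refine Nat.mul_le_mul_left c ?_
    rw [← Finset.card_insert_of_notMem (a := N) (by simp)]
    refine Finset.card_le_card fun i hi => ?_
    simp only [Finset.mem_insert, Finset.mem_filter, Finset.mem_Ico] at hi ⊢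
    rcases hi with rfl | ⟨⟨hi1, hiN⟩, ⟨j, hj, hij⟩, j', hj', hij'⟩
    · exact ⟨⟨hN0, i.lt_succ_self⟩, ⟨i, hN, IsAncestor.refl p i⟩, l, hl,
        fun hc => (hc.le hp).not_gt hlN'⟩
    · refine ⟨⟨hi1, hiN.trans N.lt_succ_self⟩, ?_, ?_⟩
      · rcases hj with rfl | hj
        · exact ⟨N, hN, IsAncestor.iff_eq_or_parent.2 (Or.inr hij)⟩
        · exact ⟨j, Finset.mem_of_mem_erase hj, hij⟩
      · rcases hj' with rfl | hj'
        · exact ⟨N, hN, fun hc => (IsAncestor.iff_eq_or_parent.1 hc).elim hiN.ne hij'⟩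
        · exact ⟨j', Finset.mem_of_mem_erase hj', hij'⟩

open Classical in
/-- Connect the centres assigned to the members of `S`, and then each member to its centre. -/
theorem Connected.steinerDist_le_card_split [Fintype V] {T : SimpleGraph V} (hT : T.Connected)
    {a : ℕ → V} {p : ℕ → ℕ} {π : V → ℕ} (hp : ∀ i, p i ≤ i) {c d N : ℕ}
    (h : ∀ i, 0 < i → i < N → p i < i ∧ T.dist (a (p i)) (a i) ≤ c)
    (hπ : ∀ v, π v < N ∧ T.dist (a (π v)) v ≤ d) {S : Finset V} (hS : S.Nonempty) :
    T.steinerDist S ≤ c * ((Finset.Ico 1 N).filter fun i =>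
      (∃ v ∈ S, v ∈ branch p π i) ∧ ∃ v ∈ S, v ∉ branch p π i).card + d * S.card := by
  have h1 := hT.steinerDist_image_le hp h (S.image π) (hS.image π) (by
    simpa using fun v _ => (hπ v).1)
  have h2 := hT.steinerDist_union_le (X := a '' (S.image π : Finset ℕ)) S fun s hs =>
    ⟨a (π s), Set.mem_image_of_mem a (Finset.mem_image_of_mem π hs), (hπ s).2⟩
  refine (hT.steinerDist_mono Set.subset_union_right).trans (h2.trans ?_)
  simpa [mem_branch] using h1

end SimpleGraph

theorem theorem3 {V : Type*} [Fintype V] (G : SimpleGraph V) [DecidableRel G.Adj]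
    (n δ : ℕ) (hconn : G.Connected) (hn : Fintype.card V = n) (hδ : G.minDegree = δ) :
    ∃ T : SimpleGraph V, T ≤ G ∧ T.IsTree ∧
      ∀ k : ℕ, 1 ≤ k →
        (T.steinerWienerIndex k : ℝ) ≤
          ((k : ℝ) - 1) / ((k : ℝ) + 1) * (3 * ((n : ℝ) + 1) / ((δ : ℝ) + 1)) * (n.choose k : ℝ)
            + (3 * (δ : ℝ) / ((δ : ℝ) + 1) + 2 * (k : ℝ)) * (n.choose k : ℝ) := by
  classical
  subst hn hδ
  obtain ⟨T, hTG, hT, N, a, p, π, hp, hlink, hπ, hfib⟩ := hconn.exists_spanningTree_packing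
  refine ⟨T, hTG, hT, fun k hk => ?_⟩
  set n := Fintype.card V
  set δ := G.minDegree
  set U := (Finset.univ : Finset V).powersetCard k with hU
  let split : ℕ → Finset V → Prop := fun i S =>
    (∃ v ∈ S, v ∈ branch p π i) ∧ ∃ v ∈ S, v ∉ branch p π i
  -- Summing over all `S` and exchanging the order of summation.
  have h1 : T.steinerWienerIndex k ≤
      3 * ∑ i ∈ Finset.Ico 1 N, (U.filter fun S => split i S).card + 2 * k * n.choose k := by
    have hcard : ∀ S ∈ U, S.card = k := fun S hS => (Finset.mem_powersetCard.1 hS).2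
    calc T.steinerWienerIndex k
        ≤ ∑ S ∈ U, (3 * ((Finset.Ico 1 N).filter fun i => split i S).card + 2 * k) := by
          refine Finset.sum_le_sum fun S hS => ?_
          have := hT.connected.steinerDist_le_card_split hp hlink hπ
            (S := S) (Finset.card_pos.1 (by rw [hcard S hS]; exact hk))
          rwa [hcard S hS] at this
      _ = _ := by
          rw [Finset.sum_add_distrib, ← Finset.mul_sum, Finset.sum_const, hU,
            Finset.card_powersetCard, Finset.card_univ, smul_eq_mul, mul_comm (n.choose k)]
          congr 2
          exact (Finset.sum_card_bipartiteAbove_eq_sum_card_bipartiteBelow split).symm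
  have h2 : (T.steinerWienerIndex k : ℝ) ≤ 3 * ∑ i ∈ Finset.Ico 1 N,
      splitCount n k (branch p π i).card + 2 * k * n.choose k := by
    have : ∀ i ∈ Finset.Ico 1 N, splitCount n k (branch p π i).card =
        ((U.filter fun S => split i S).card : ℝ) := fun i _ =>
      (card_powersetCard_split hk (branch p π i)).symm
    rw [Finset.sum_congr rfl this]
    exact_mod_cast h1
  have h3 := mul_sum_splitCount_le (n := n) (m := δ + 1) hk (Nat.succ_pos _) (Finset.Ico 1 N)
    (fun i => (branch p π i).card) (fun i _ => Finset.card_le_univ _) fun x hx =>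
      card_balanced_branches_le hp hfib hx _ fun i hi => by
        simp only [Finset.mem_filter, Finset.mem_Ico] at hi
        exact ⟨hi.1.1, hi.1.2, hi.2⟩
  set W := ∑ i ∈ Finset.Ico 1 N, splitCount n k (branch p π i).card
  have hδ : (0 : ℝ) < δ + 1 := by positivity
  push_cast at h3
  rw [mul_comm, ← le_div_iff₀ hδ] at h3
  refine h2.trans ((add_le_add_left (mul_le_mul_of_nonneg_left h3 (by norm_num)) _).trans_eq ?_)
  field_simp
  ring
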